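/- Let $\mathbb H^n_{\mathbb C}$ be complex hyperbolic $n$-space, i.e. the open unit ball of $\mathbb C^n$ with the Bergman metric $d$ normalised to have sectional curvature between $-1$ and $-1/4$, so that $\cosh^2\frac{d(z,w)}2=\frac{|1-\sum_i z_i\bar w_i|^2}{(1-|z|^2)(1-|w|^2)}$. The projective unitary group $PU(n,1)$ acts on the ball and on its closure by fractional linear maps. An element of $PU(n,1)$ is parabolic if it has exactly one fixed point in the closed ball and this point lies on the boundary sphere. For a subgroup $G\subset PU(n,1)$ and a point $y\in\mathbb H^n_{\mathbb C}$ the Dirichlet polyhedron centered at $y$ is $$D_y(G)=\{z\in\mathbb H^n_{\mathbb C} : d(z,y)\le d(z,gy)\ \text{ for all } g\in G\},$$ and a side of $D_y(G)$ is a set of the form $D_y(G)\cap B$, where $B=\{z\in\mathbb H^n_{\mathbb C} : d(z,y)=d(z,gy)\}$ for some $g\in G$ with $gy\neq y$, that contains a nonempty relatively open subset of the hypersurface $B$. **Theorem 3.1.** For any discrete group $G\subset PU(n,1)$ generated by a single parabolic element, there is a point $y_0\in\mathbb H^n_{\mathbb C}$ such that the Dirichlet polyhedron $D_{y_0}(G)$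 has exactly two sides. -/

import Mathlib

open scoped Matrix

noncomputable section

namespace ComplexHyperbolic

/-! ## The Hermitian form of signature `(n,1)` and the group `PU(n,1)` -/

/-- The standard Hermitian form of signature `(n,1)` on `ℂⁿ ⊕ ℂ`:
`⟨v,w⟩ = v₁ w̄₁ + ⋯ + vₙ w̄ₙ - vₙ₊₁ w̄ₙ₊₁`. -/
def herm {n : ℕ} (v w : Fin n ⊕ Unit → ℂ) : ℂ :=
  (∑ i, v (Sum.inl i) * star (w (Sum.inl i))) - v (Sum.inr ()) * star (w (Sum.inr ()))

/-- The unitary group `U(n,1)`: the invertible complex matrices that preserve the form. -/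
def U (n : ℕ) : Subgroup (GL (Fin n ⊕ Unit) ℂ) where
  carrier := {A | ∀ v w, herm (A.val *ᵥ v) (A.val *ᵥ w) = herm v w}
  one_mem' := by
    intro v w
    simp
  mul_mem' := by
    intro A B hA hB v w
    simp only [Units.val_mul, ← Matrix.mulVec_mulVec]
    rw [hA, hB]
  inv_mem' := by
    intro A hA v w
    rw [← hA]
    simp only [Matrix.mulVec_mulVec, Units.mul_inv, Matrix.one_mulVec]

/-- The subgroup of scalar matrices in `U(n,1)`. -/
def scalars (n : ℕ) : Subgroup (U n) :=
  (Matrix.GeneralLinearGroup.scalar (R := ℂ) (Fin n ⊕ Unit)).range.subgroupOf (U n)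

instance scalars_normal (n : ℕ) : (scalars n).Normal where
  conj_mem := by
    rintro A ⟨c, hc⟩ B
    refine ⟨c, ?_⟩
    have h := Matrix.GeneralLinearGroup.scalar_commute c (B : GL (Fin n ⊕ Unit) ℂ)
    change _ = (A : GL (Fin n ⊕ Unit) ℂ) at hc
    change _ = (B : GL (Fin n ⊕ Unit) ℂ) * (A : GL (Fin n ⊕ Unit) ℂ) * (B : GL (Fin n ⊕ Unit) ℂ)⁻¹
    rw [← hc, ← h, mul_inv_cancel_right]

/-- The projective unitary group `PU(n,1) = U(n,1) / {scalars}`; it carries the quotient of the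
topology that `U(n,1)` inherits from the complex matrices. -/
abbrev PU (n : ℕ) : Type := U n ⧸ scalars n

/-! ## The ball model and the action of `PU(n,1)` -/

/-- Complex hyperbolic `n`-space (as a set): the open unit ball of `ℂⁿ`. -/
abbrev CH (n : ℕ) : Type := Metric.ball (0 : EuclideanSpace ℂ (Fin n)) 1

/-- Complex hyperbolic `n`-space with its boundary at infinity: the closed unit ball of `ℂⁿ`. -/
abbrev CHbar (n : ℕ) : Type := Metric.closedBall (0 : EuclideanSpace ℂ (Fin n)) 1

/-- Homogeneous coordinates `(z, 1)` of a point `z` of `ℂⁿ`. -/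
def homog {n : ℕ} (z : EuclideanSpace ℂ (Fin n)) : Fin n ⊕ Unit → ℂ :=
  Sum.elim (fun i => z i) (fun _ => 1)

/-- The point of `ℂⁿ` with homogeneous coordinates `v` (meaningful for `vₙ₊₁ ≠ 0`). -/
def dehomog {n : ℕ} (v : Fin n ⊕ Unit → ℂ) : EuclideanSpace ℂ (Fin n) :=
  WithLp.toLp 2 (fun i => v (Sum.inl i) / v (Sum.inr ()))

theorem herm_self {n : ℕ} (v : Fin n ⊕ Unit → ℂ) :
    herm v v = (((∑ i, ‖v (Sum.inl i)‖ ^ 2) - ‖v (Sum.inr ())‖ ^ 2 : ℝ) : ℂ) := by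
  simp [herm, Complex.mul_conj, Complex.normSq_eq_norm_sq]

theorem herm_homog_self {n : ℕ} (z : EuclideanSpace ℂ (Fin n)) :
    herm (homog z) (homog z) = ((‖z‖ ^ 2 - 1 : ℝ) : ℂ) := by
  rw [herm_self, EuclideanSpace.norm_sq_eq]
  simp [homog]

theorem norm_dehomog {n : ℕ} (v : Fin n ⊕ Unit → ℂ) :
    ‖dehomog v‖ ^ 2 * ‖v (Sum.inr ())‖ ^ 2 =
      if v (Sum.inr ()) = 0 then 0 else ∑ i, ‖v (Sum.inl i)‖ ^ 2 := by
  split_ifs with h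
  · simp [h]
  · have h' : ‖v (Sum.inr ())‖ ^ 2 ≠ 0 := by simpa using h
    rw [EuclideanSpace.norm_sq_eq, Finset.sum_mul]
    refine Finset.sum_congr rfl fun i _ => ?_
    simp only [dehomog, norm_div, div_pow]
    exact div_mul_cancel₀ _ h'

theorem last_ne_zero {n : ℕ} (A : U n) (z : CHbar n) :
    (A.1.val *ᵥ homog z.1) (Sum.inr ()) ≠ 0 := by
  intro h0
  have h1 := A.2 (homog z.1) (homog z.1)
  have hz : ‖z.1‖ ≤ 1 := mem_closedBall_zero_iff.1 z.2
  rw [herm_self, herm_homog_self, h0] at h1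
  have h2 := Complex.ofReal_injective h1
  have h3 : ∑ i, ‖(A.1.val *ᵥ homog z.1) (Sum.inl i)‖ ^ 2 = 0 := by
    refine le_antisymm ?_ (Finset.sum_nonneg fun i _ => by positivity)
    simp only [norm_zero] at h2
    nlinarith [norm_nonneg z.1]
  rw [Finset.sum_eq_zero_iff_of_nonneg (fun i _ => by positivity)] at h3
  have h4 : A.1.val *ᵥ homog z.1 = 0 := by
    funext j
    rcases j with i | u
    · simpa using h3 i (Finset.mem_univ i)
    · exact h0
  have h5 : homog z.1 = 0 := by
    have : (A.1⁻¹).val *ᵥ (A.1.val *ᵥ homog z.1) = 0 := by rw [h4, Matrix.mulVec_zero]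
    simpa only [Matrix.mulVec_mulVec, Units.inv_mul, Matrix.one_mulVec] using this
  simpa [homog] using congrFun h5 (Sum.inr ())

/-- `U(n,1)` acts on the ball by fractional linear maps. -/
def frac {n : ℕ} (A : U n) (z : EuclideanSpace ℂ (Fin n)) : EuclideanSpace ℂ (Fin n) :=
  dehomog (A.1.val *ᵥ homog z)

theorem frac_norm {n : ℕ} (A : U n) (z : CHbar n) :
    (‖frac A z.1‖ ^ 2 - 1) * ‖(A.1.val *ᵥ homog z.1) (Sum.inr ())‖ ^ 2 = ‖z.1‖ ^ 2 - 1 := by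
  have h1 := A.2 (homog z.1) (homog z.1)
  rw [herm_self, herm_homog_self] at h1
  have h2 := Complex.ofReal_injective h1
  have h3 := norm_dehomog (A.1.val *ᵥ homog z.1)
  rw [if_neg (last_ne_zero A z)] at h3
  rw [sub_mul, frac, h3, one_mul, h2]

theorem frac_norm_le {n : ℕ} (A : U n) (z : CHbar n) : ‖frac A z.1‖ ≤ 1 := by
  have h := frac_norm A z
  have hp : 0 < ‖(A.1.val *ᵥ homog z.1) (Sum.inr ())‖ ^ 2 := by
    have := norm_pos_iff.2 (last_ne_zero A z)
    positivity
  have hz : ‖z.1‖ ≤ 1 := mem_closedBall_zero_iff.1 z.2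
  by_contra! hc
  have : 0 < (‖frac A z.1‖ ^ 2 - 1) * ‖(A.1.val *ᵥ homog z.1) (Sum.inr ())‖ ^ 2 :=
    mul_pos (by nlinarith) hp
  nlinarith [norm_nonneg z.1]

theorem frac_norm_lt {n : ℕ} (A : U n) (z : CHbar n) (hz : ‖z.1‖ < 1) : ‖frac A z.1‖ < 1 := by
  have h := frac_norm A z
  by_contra! hc
  have : 0 ≤ (‖frac A z.1‖ ^ 2 - 1) * ‖(A.1.val *ᵥ homog z.1) (Sum.inr ())‖ ^ 2 :=
    mul_nonneg (by nlinarith) (by positivity)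
  nlinarith [norm_nonneg z.1]

theorem dehomog_smul {n : ℕ} (c : ℂ) (hc : c ≠ 0) (v : Fin n ⊕ Unit → ℂ) :
    dehomog (c • v) = dehomog v := by
  ext i
  simp [dehomog, mul_div_mul_left _ _ hc]

theorem dehomog_homog {n : ℕ} (z : EuclideanSpace ℂ (Fin n)) : dehomog (homog z) = z := by
  ext i
  simp [dehomog, homog]

theorem homog_dehomog {n : ℕ} (v : Fin n ⊕ Unit → ℂ) (hv : v (Sum.inr ()) ≠ 0) :
    homog (dehomog v) = (v (Sum.inr ()))⁻¹ • v := by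
  funext j
  rcases j with i | u
  · simp [homog, dehomog, div_eq_inv_mul]
  · simp [homog, hv]

theorem frac_mul {n : ℕ} (A B : U n) (z : CHbar n) :
    frac (A * B) z.1 = frac A (frac B z.1) := by
  have hB := last_ne_zero B z
  simp only [frac]
  rw [homog_dehomog _ hB, Matrix.mulVec_smul, dehomog_smul _ (inv_ne_zero hB),
    Matrix.mulVec_mulVec]
  rfl

/-- The action of `U(n,1)` on the closed ball. -/
instance actU (n : ℕ) : MulAction (U n) (CHbar n) where
  smul A z := ⟨frac A z.1, by simpa using frac_norm_le A z⟩
  one_smul z := by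
    apply Subtype.ext
    change frac 1 z.1 = z.1
    simp [frac, dehomog_homog]
  mul_smul A B z := by
    apply Subtype.ext
    exact frac_mul A B z

theorem scalars_act {n : ℕ} (A : U n) (hA : A ∈ scalars n) :
    MulAction.toPermHom (U n) (CHbar n) A = 1 := by
  obtain ⟨c, hc⟩ := hA
  change _ = (A : GL (Fin n ⊕ Unit) ℂ) at hc
  ext1 z
  apply Subtype.ext
  change dehomog (A.1.val *ᵥ homog z.1) = z.1
  rw [← hc, Matrix.GeneralLinearGroup.coe_scalar]
  have : Matrix.scalar (Fin n ⊕ Unit) (c : ℂ) *ᵥ homog z.1 = (c : ℂ) • homog z.1 := by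
    funext j
    simp [Matrix.mulVec_diagonal]
  rw [this, dehomog_smul _ c.ne_zero, dehomog_homog]

/-- The action of `PU(n,1)` on the closed ball, induced by that of `U(n,1)`. -/
instance actBar (n : ℕ) : MulAction (PU n) (CHbar n) :=
  MulAction.compHom (CHbar n)
    (QuotientGroup.lift (scalars n) (MulAction.toPermHom (U n) (CHbar n)) scalars_act)

theorem mk_smul {n : ℕ} (A : U n) (z : CHbar n) : ((A : PU n) • z).1 = frac A z.1 := rfl

/-- A point of the open ball as a point of the closed ball. -/
def toBar {n : ℕ} (z : CH n) : CHbar n := ⟨z.1, Metric.ball_subset_closedBall z.2⟩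

theorem smul_mem_ball {n : ℕ} (g : PU n) (z : CH n) :
    (g • toBar z).1 ∈ Metric.ball (0 : EuclideanSpace ℂ (Fin n)) 1 := by
  induction g using QuotientGroup.induction_on with
  | H A =>
    rw [mk_smul]
    exact mem_ball_zero_iff.2 (frac_norm_lt A (toBar z) (mem_ball_zero_iff.1 z.2))

/-- The action of `PU(n,1)` on complex hyperbolic space, by restriction. -/
instance act (n : ℕ) : MulAction (PU n) (CH n) where
  smul g z := ⟨(g • toBar z).1, smul_mem_ball g z⟩
  one_smul z := by
    apply Subtype.ext
    change ((1 : PU n) • toBar z).1 = z.1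
    rw [one_smul]
    rfl
  mul_smul g h z := by
    apply Subtype.ext
    change ((g * h) • toBar z).1 = _
    rw [mul_smul]
    rfl

/-- An element of `PU(n,1)` is parabolic if it has exactly one fixed point in the closed ball,
and this point lies on the boundary sphere. -/
def IsParabolic {n : ℕ} (g : PU n) : Prop :=
  ∃ p : CHbar n, ‖p.1‖ = 1 ∧ ∀ q : CHbar n, g • q = q ↔ q = p

/-! ## The Bergman metric, bisectors and Dirichlet polyhedra -/

/-- The distance of the Bergman metric on the ball, normalised to have sectional curvature
between `-1` and `-1/4`: for `Z = (z,1)`, `W = (w,1)`,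
`cosh² (d(z,w) / 2) = ⟨Z,W⟩ ⟨W,Z⟩ / (⟨Z,Z⟩ ⟨W,W⟩)`. -/
def bdist {n : ℕ} (z w : CH n) : ℝ :=
  2 * Real.arcosh (‖herm (homog z.1) (homog w.1)‖ /
    √((herm (homog z.1) (homog z.1)).re * (herm (homog w.1) (homog w.1)).re))

/-- The bisector (equidistant hypersurface) of two points. -/
def bisector {n : ℕ} (y y' : CH n) : Set (CH n) := {z | bdist z y = bdist z y'}

/-- The Dirichlet polyhedron of `G` centred at `y`. -/
def dirichlet {n : ℕ} (G : Subgroup (PU n)) (y : CH n) : Set (CH n) :=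
  {z | ∀ g ∈ G, bdist z y ≤ bdist z (g • y)}

/-- `S` is a side of the Dirichlet polyhedron `D` of `G` centred at `y`: it is the intersection
of `D` with the bisector of `y` and some `g y ≠ y`, `g ∈ G`, and it has codimension one, i.e. it
contains a nonempty relatively open subset of that bisector. -/
def IsSide {n : ℕ} (G : Subgroup (PU n)) (y : CH n) (S : Set (CH n)) : Prop :=
  ∃ g ∈ G, g • y ≠ y ∧ S = dirichlet G y ∩ bisector y (g • y) ∧
    ∃ V : Set (CH n), IsOpen V ∧ (V ∩ bisector y (g • y)).Nonempty ∧
      V ∩ bisector y (g • y) ⊆ S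

end ComplexHyperbolic

end

/-!
A parabolic isometry `g` has a representative `A ∈ U(n,1)` that fixes a null vector `p`. The map
that `A` induces on the definite space `p^⊥ / p` is unitary, so by the Fitting decomposition of
`A - 1` some negative vector `y` satisfies `(A - 1)² y ∈ ℂ p`. On such a vector the powers of `A`
agree with a unipotent one-parameter group: `A ^ k y = γ k` for a quadratic curve
`γ x = y + x u + (x² / 2) ⟨u,u⟩ p`.

If `z` is negative, `|⟨z, γ x⟩|²` is, up to scaling `z`, the sum of the squares of a positive convex
quadratic polynomial and of an affine function, hence strictly convex in `x`. So along the orbit of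
`y` the distance to any point is strictly quasiconvex: once `z` is at least as close to `y` as to
`g y` and `g⁻¹ y`, it is strictly closer to `y` than to every other point of the orbit, and only the
bisectors of `g` and `g⁻¹` contribute sides. They are nonempty because they contain the points
`γ (1 / 2)` and `γ (-1 / 2)`.
-/

namespace ComplexHyperbolic

section StrictQuasiconvex

/-- Strict quasiconvexity of a function on an ordered set: at an intermediate argument the value is
below the larger of the two outer values. It is used for functions on `ℝ` and on `ℤ`. -/
def StrictQuasiconvex {α β : Type*} [Preorder α] [LinearOrder β] (f : α → β) : Prop :=
  ∀ ⦃i j k⦄, i < j → j < k → f j < max (f i) (f k)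

variable {α β : Type*} [Preorder α] [LinearOrder β] {f : α → β}

theorem StrictQuasiconvex.lt_right (hf : StrictQuasiconvex f) {i j k : α} (hij : i < j)
    (hjk : j < k) (h : f i ≤ f j) : f j < f k :=
  (lt_max_iff.1 (hf hij hjk)).resolve_left h.not_gt

theorem StrictQuasiconvex.lt_left (hf : StrictQuasiconvex f) {i j k : α} (hij : i < j)
    (hjk : j < k) (h : f k ≤ f j) : f j < f i :=
  (lt_max_iff.1 (hf hij hjk)).resolve_right h.not_gt

theorem StrictQuasiconvex.of_lt_imp_lt {δ : Type*} [LinearOrder δ] {f' : α → δ}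
    (hf : StrictQuasiconvex f) (h : ∀ i j, f i < f j → f' i < f' j) : StrictQuasiconvex f' :=
  fun _ _ _ hij hjk => lt_max_iff.2 ((lt_max_iff.1 (hf hij hjk)).imp (h _ _) (h _ _))

theorem StrictQuasiconvex.comp_strictMono {δ : Type*} [Preorder δ] {φ : δ → α}
    (hf : StrictQuasiconvex f) (hφ : StrictMono φ) : StrictQuasiconvex (f ∘ φ) :=
  fun _ _ _ hij hjk => hf (hφ hij) (hφ hjk)

theorem strictQuasiconvex_of_strictConvexOn {f : ℝ → ℝ} (hf : StrictConvexOn ℝ Set.univ f) :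
    StrictQuasiconvex f := fun i j k hij hjk =>
  hf.lt_on_openSegment (Set.mem_univ i) (Set.mem_univ k) (hij.trans hjk).ne
    (by rw [openSegment_eq_Ioo (hij.trans hjk)]; exact ⟨hij, hjk⟩)

theorem strictConvexOn_sq_add_sq {a b c d e : ℝ} (hpos : ∀ x : ℝ, 0 < a * x ^ 2 + b * x + c)
    (ha : 0 ≤ a) (had : a ≠ 0 ∨ d ≠ 0) :
    StrictConvexOn ℝ Set.univ fun x : ℝ => (a * x ^ 2 + b * x + c) ^ 2 + (d * x + e) ^ 2 := by
  have hquad (x : ℝ) : HasDerivAt (fun x => a * x ^ 2 + b * x + c) (2 * a * x + b) x :=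
    ((((hasDerivAt_pow 2 x).const_mul a).add ((hasDerivAt_id x).const_mul b)).add_const
      c).congr_deriv (by push_cast; ring)
  have haff (r s x : ℝ) : HasDerivAt (fun x => r * x + s) r x := by
    simpa using ((hasDerivAt_id x).const_mul r).add_const s
  have hderiv : deriv (fun x : ℝ => (a * x ^ 2 + b * x + c) ^ 2 + (d * x + e) ^ 2) =
      fun x => 2 * ((a * x ^ 2 + b * x + c) * (2 * a * x + b) + (d * x + e) * d) := by
    ext x
    exact ((((hquad x).pow 2).add ((haff d e x).pow 2)).congr_deriv (by push_cast; ring)).deriv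
  have hderiv2 (x : ℝ) : deriv^[2] (fun x : ℝ => (a * x ^ 2 + b * x + c) ^ 2 + (d * x + e) ^ 2) x =
      2 * ((2 * a * x + b) ^ 2 + (a * x ^ 2 + b * x + c) * (2 * a) + d ^ 2) := by
    rw [Function.iterate_succ_apply, Function.iterate_one, hderiv]
    exact (((((hquad x).mul (haff (2 * a) b x)).add ((haff d e x).mul_const d)).const_mul
      2).congr_deriv (by ring)).deriv
  refine strictConvexOn_univ_of_deriv2_pos (by fun_prop) fun x => ?_
  rw [hderiv2]
  have hP := hpos x
  rcases had with ha0 | hd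
  · have := ha.lt_of_ne' ha0
    positivity
  · positivity

end StrictQuasiconvex

/-- The Hermitian space `ℂ^{n,1}` of homogeneous coordinates, on which `herm` is the form. -/
abbrev Vec (n : ℕ) : Type := Fin n ⊕ Unit → ℂ

section Form

variable {n : ℕ} {p v w : Vec n}

theorem herm_add_left (u v w : Vec n) : herm (u + v) w = herm u w + herm v w := by
  simp only [herm, Pi.add_apply, add_mul, Finset.sum_add_distrib]; ring

theorem herm_smul_left (c : ℂ) (v w : Vec n) : herm (c • v) w = c * herm v w := by
  simp only [herm, Pi.smul_apply, smul_eq_mul, mul_sub, Finset.mul_sum, mul_assoc]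

theorem star_herm (v w : Vec n) : star (herm v w) = herm w v := by
  simp only [herm, star_sub, star_sum, star_mul', star_star, mul_comm]

theorem herm_add_right (u v w : Vec n) : herm u (v + w) = herm u v + herm u w := by
  rw [← star_herm, herm_add_left, star_add, star_herm, star_herm]

theorem herm_smul_right (c : ℂ) (v w : Vec n) : herm v (c • w) = star c * herm v w := by
  rw [← star_herm, herm_smul_left, star_mul', star_herm]

theorem herm_sub_left (u v w : Vec n) : herm (u - v) w = herm u w - herm v w := by
  rw [eq_sub_iff_add_eq, ← herm_add_left, sub_add_cancel]

theorem herm_sub_right (u v w : Vec n) : herm u (v - w) = herm u v - herm u w := by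
  rw [eq_sub_iff_add_eq, ← herm_add_right, sub_add_cancel]

theorem herm_zero_left (w : Vec n) : herm 0 w = 0 := by
  simpa using herm_smul_left 0 0 w

theorem herm_eq_zero_comm : herm v w = 0 ↔ herm w v = 0 := by
  rw [← star_herm, star_eq_zero]

theorem re_herm_comm (v w : Vec n) : (herm v w).re = (herm w v).re := by
  rw [← star_herm w v, Complex.star_def, Complex.conj_re]

theorem ofReal_re_herm_self (v : Vec n) : ((herm v v).re : ℂ) = herm v v := by
  rw [herm_self, Complex.ofReal_re]

theorem star_herm_self (v : Vec n) : star (herm v v) = herm v v := star_herm v v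

theorem herm_smul_smul_self (c : ℂ) (v w : Vec n) :
    herm (c • v) (c • w) = (‖c‖ ^ 2 : ℝ) * herm v w := by
  rw [herm_smul_left, herm_smul_right, ← mul_assoc, Complex.star_def, Complex.mul_conj',
    Complex.ofReal_pow]

theorem re_herm_smul_self (c : ℂ) (v : Vec n) :
    (herm (c • v) (c • v)).re = ‖c‖ ^ 2 * (herm v v).re := by
  rw [herm_smul_smul_self, Complex.re_ofReal_mul]

theorem ne_zero_of_re_herm_self_neg (hv : (herm v v).re < 0) : v ≠ 0 := by
  rintro rfl
  simp [herm_zero_left] at hv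

theorem eq_zero_of_forall_herm_eq_zero (h : ∀ v, herm v w = 0) : w = 0 := by
  funext i
  have hi := h (Pi.single i 1)
  rcases i with i | ⟨⟩ <;> simpa [herm, Pi.single_apply] using hi

theorem re_herm_self_of_last_eq_zero (hv : v (Sum.inr ()) = 0) :
    (herm v v).re = ∑ i, ‖v (Sum.inl i)‖ ^ 2 := by
  rw [herm_self, hv, Complex.ofReal_re, norm_zero, zero_pow two_ne_zero, sub_zero]

theorem eq_zero_of_last_eq_zero (hv : v (Sum.inr ()) = 0) (hvv : (herm v v).re ≤ 0) : v = 0 := by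
  have hsum : ∑ i, ‖v (Sum.inl i)‖ ^ 2 = 0 :=
    le_antisymm (re_herm_self_of_last_eq_zero hv ▸ hvv) (by positivity)
  rw [Finset.sum_eq_zero_iff_of_nonneg fun i _ => by positivity] at hsum
  funext j
  rcases j with i | ⟨⟩
  · simpa using hsum i (Finset.mem_univ i)
  · exact hv

theorem last_ne_zero_of_nonpos (hv : v ≠ 0) (hvv : (herm v v).re ≤ 0) : v (Sum.inr ()) ≠ 0 :=
  fun h => hv (eq_zero_of_last_eq_zero h hvv)

theorem re_herm_sub_smul_self (hvp : herm v p = 0) (c : ℂ) :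
    (herm (v - c • p) (v - c • p)).re = (herm v v).re + ‖c‖ ^ 2 * (herm p p).re := by
  rw [← re_herm_smul_self]
  simp [herm_sub_left, herm_sub_right, herm_smul_left, herm_smul_right, hvp,
    herm_eq_zero_comm.1 hvp]

theorem re_herm_self_nonneg_of_orthogonal (hp0 : p ≠ 0) (hp : (herm p p).re ≤ 0)
    (hvp : herm v p = 0) : 0 ≤ (herm v v).re := by
  have hlast := last_ne_zero_of_nonpos hp0 hp
  set c := v (Sum.inr ()) / p (Sum.inr ())
  have hpos : 0 ≤ (herm (v - c • p) (v - c • p)).re := by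
    rw [re_herm_self_of_last_eq_zero (by simp [c, hlast])]
    positivity
  rw [re_herm_sub_smul_self hvp] at hpos
  linarith [mul_nonpos_of_nonneg_of_nonpos (sq_nonneg ‖c‖) hp]

theorem mem_span_of_orthogonal (hp0 : p ≠ 0) (hp : (herm p p).re ≤ 0) (hvp : herm v p = 0)
    (hvv : (herm v v).re ≤ 0) : v ∈ Submodule.span ℂ {p} := by
  have hlast := last_ne_zero_of_nonpos hp0 hp
  set c := v (Sum.inr ()) / p (Sum.inr ())
  have hzero : v - c • p = 0 := by
    refine eq_zero_of_last_eq_zero (by simp [c, hlast]) ?_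
    rw [re_herm_sub_smul_self hvp]
    linarith [mul_nonpos_of_nonneg_of_nonpos (sq_nonneg ‖c‖) hp]
  exact Submodule.mem_span_singleton.2 ⟨c, (sub_eq_zero.1 hzero).symm⟩

theorem herm_ne_zero_of_neg_of_nonpos (hv : (herm v v).re < 0) (hp0 : p ≠ 0)
    (hp : (herm p p).re ≤ 0) : herm v p ≠ 0 := fun h =>
  (re_herm_self_nonneg_of_orthogonal hp0 hp h).not_gt hv

end Form

section Isometry

variable {n : ℕ} {T : Module.End ℂ (Vec n)} {p : Vec n}

theorem herm_self_eq_zero_of_norm_ne_one (hT : ∀ v w, herm (T v) (T w) = herm v w) {m : ℂ}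
    (hm : ‖m‖ ≠ 1) {w : Vec n} (hw : T w = m • w) : herm w w = 0 := by
  have h := hT w w
  rw [hw, herm_smul_smul_self] at h
  have hm2 : ((‖m‖ ^ 2 : ℝ) : ℂ) ≠ 1 := by
    rw [Ne, Complex.ofReal_eq_one, pow_eq_one_iff_of_nonneg (norm_nonneg m) two_ne_zero]
    exact hm
  by_contra hww
  exact hm2 ((mul_eq_right₀ hww).1 h)

theorem hasEigenvalue_inv_star (hT : ∀ v w, herm (T v) (T w) = herm v w) {l : ℂ} (hl : l ≠ 0)
    (h : T.HasEigenvalue l) : T.HasEigenvalue (star l)⁻¹ := by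
  obtain ⟨p, hp⟩ := h.exists_hasEigenvector
  have horth (v : Vec n) : herm (T v - (star l)⁻¹ • v) p = 0 := by
    have hv := hT v p
    rw [hp.apply_eq_smul, herm_smul_right] at hv
    rw [herm_sub_left, herm_smul_left, ← hv, inv_mul_cancel_left₀ (star_ne_zero.2 hl), sub_self]
  by_contra hne
  rw [Module.End.hasEigenvalue_iff_mem_spectrum, spectrum.notMem_iff, ← IsUnit.neg_iff,
    neg_sub, LinearMap.isUnit_iff_range_eq_top, LinearMap.range_eq_top] at hne
  refine hp.2 (eq_zero_of_forall_herm_eq_zero fun v => ?_)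
  obtain ⟨w, rfl⟩ := hne v
  exact horth w

theorem herm_sub_one_apply (hT : ∀ v w, herm (T v) (T w) = herm v w) (hTp : T p = p) (v : Vec n) :
    herm ((T - 1) v) p = 0 := by
  have h := hT v p
  rw [hTp] at h
  rw [LinearMap.sub_apply, Module.End.one_apply, herm_sub_left, h, sub_self]

/-- An isometry of the definite space `p^⊥ / p` has no Jordan block of size two for the
eigenvalue `1`. -/
theorem sub_one_apply_mem_span (hT : ∀ v w, herm (T v) (T w) = herm v w) (hp0 : p ≠ 0)
    (hp : herm p p = 0) (hTp : T p = p) {w : Vec n} (hw : herm w p = 0)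
    (h : (T - 1) ((T - 1) w) ∈ Submodule.span ℂ {p}) : (T - 1) w ∈ Submodule.span ℂ {p} := by
  obtain ⟨c, hc⟩ := Submodule.mem_span_singleton.1 h
  have hup := herm_sub_one_apply hT hTp w
  set u := (T - 1) w with hu
  have hTw : T w = w + u := by simp [hu]
  have hTu : T u = u + c • p := by simp [hc]
  have huu : herm u u = 0 := by
    have hwu := hT w u
    rw [hTw, hTu, herm_add_left, herm_add_right, herm_add_right, herm_smul_right,
      herm_smul_right, hw, hup] at hwu
    linear_combination hwu
  exact mem_span_of_orthogonal hp0 (by simp [hp]) hup (by simp [huu])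

theorem sub_one_apply_mem_span_of_pow (hT : ∀ v w, herm (T v) (T w) = herm v w) (hp0 : p ≠ 0)
    (hp : herm p p = 0) (hTp : T p = p) {w : Vec n} (hw : herm w p = 0) (j : ℕ)
    (h : ((T - 1) ^ (j + 1)) w ∈ Submodule.span ℂ {p}) :
    (T - 1) w ∈ Submodule.span ℂ {p} := by
  induction j generalizing w with
  | zero => simpa using h
  | succ j ih =>
    refine sub_one_apply_mem_span hT hp0 hp hTp hw (ih (herm_sub_one_apply hT hTp w) ?_)
    rwa [pow_succ, Module.End.mul_apply] at h

theorem exists_sub_one_sq_apply_mem_span (hT : ∀ v w, herm (T v) (T w) = herm v w) (hp0 : p ≠ 0)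
    (hp : herm p p = 0) (hTp : T p = p) :
    ∃ v, herm v p = -1 ∧ (T - 1) ((T - 1) v) ∈ Submodule.span ℂ {p} := by
  obtain ⟨m, hm⟩ := Filter.eventually_atTop.1 (T - 1).eventually_isCompl_ker_pow_range_pow
  have hFitting := (hm (m + 2) (by lia)).sup_eq_top
  obtain ⟨v, hv, hvp⟩ : ∃ v ∈ LinearMap.ker ((T - 1) ^ (m + 2)), herm v p ≠ 0 := by
    by_contra! hker
    refine hp0 (eq_zero_of_forall_herm_eq_zero fun w => ?_)
    obtain ⟨v, hv, _, ⟨u, rfl⟩, rfl⟩ := Submodule.mem_sup.1 (hFitting ▸ Submodule.mem_top : w ∈ _)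
    rw [herm_add_left, hker v hv, pow_succ', Module.End.mul_apply, herm_sub_one_apply hT hTp,
      add_zero]
  have hspan : (T - 1) ((T - 1) v) ∈ Submodule.span ℂ {p} := by
    refine sub_one_apply_mem_span_of_pow hT hp0 hp hTp (herm_sub_one_apply hT hTp v) m ?_
    rw [← Module.End.mul_apply, ← pow_succ, LinearMap.mem_ker.1 hv]
    exact zero_mem _
  refine ⟨(-(herm v p)⁻¹) • v, ?_, ?_⟩
  · rw [herm_smul_left, neg_mul, inv_mul_cancel₀ hvp]
  · rw [map_smul, map_smul]
    exact Submodule.smul_mem _ _ hspan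

theorem exists_neg_sub_one_sq_apply_mem_span (hT : ∀ v w, herm (T v) (T w) = herm v w)
    (hp0 : p ≠ 0) (hp : herm p p = 0) (hTp : T p = p) :
    ∃ y, (herm y y).re < 0 ∧ herm y p = -1 ∧
      (T - 1) ((T - 1) y) ∈ Submodule.span ℂ {p} := by
  obtain ⟨v, hvp, hv⟩ := exists_sub_one_sq_apply_mem_span hT hp0 hp hTp
  have hpv : herm p v = -1 := by rw [← star_herm, hvp, star_neg, star_one]
  set c : ℝ := (herm v v).re / 2 + 1 with hc
  refine ⟨v + (c : ℂ) • p, ?_, ?_, ?_⟩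
  · have hcc : herm (v + (c : ℂ) • p) (v + (c : ℂ) • p) = herm v v - (2 * c : ℝ) := by
      simp only [herm_add_left, herm_add_right, herm_smul_left, herm_smul_right, hvp, hpv, hp,
        Complex.star_def, Complex.conj_ofReal]
      push_cast; ring
    rw [hcc, Complex.sub_re, Complex.ofReal_re]
    linarith
  · rw [herm_add_left, hvp, herm_smul_left, hp, mul_zero, add_zero]
  · have hp1 : (T - 1) p = 0 := by rw [LinearMap.sub_apply, hTp, Module.End.one_apply, sub_self]
    rwa [map_add, map_smul, hp1, smul_zero, add_zero]

end Isometry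

section Horocycle

variable {n : ℕ} {p u y : Vec n}

/-- The data of an orbit of a unipotent one-parameter group `exp (x N)` of isometries, where
`N y = u`, `N u = ⟨u,u⟩ p` and `N p = 0`. The orthogonality relations say that `N` is skew for the
form, and `p` is normalised against the negative vector `y`. -/
structure IsHorocyclicFrame (p u y : Vec n) : Prop where
  herm_p_p : herm p p = 0
  herm_u_p : herm u p = 0
  herm_y_p : herm y p = -1
  re_herm_y_u : (herm y u).re = 0
  re_herm_y_y : (herm y y).re < 0

/-- The orbit `x ↦ exp (x N) y` of the one-parameter group attached to a horocyclic frame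
`p, u, y`. -/
noncomputable def horocycle (p u y : Vec n) (x : ℝ) : Vec n :=
  y + (x : ℂ) • u + ((x : ℂ) ^ 2 / 2 * herm u u) • p

theorem herm_horocycle_right (z p u y : Vec n) (x : ℝ) :
    herm z (horocycle p u y x) =
      herm z y + x * herm z u + (x : ℂ) ^ 2 / 2 * herm u u * herm z p := by
  simp only [horocycle, herm_add_right, herm_smul_right, star_mul', star_herm_self]
  simp

theorem exists_isHorocyclicFrame_of_apply_eq_self {T : Module.End ℂ (Vec n)}
    (hT : ∀ v w, herm (T v) (T w) = herm v w) (hp0 : p ≠ 0) (hp : herm p p = 0) (hTp : T p = p) :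
    ∃ u y, IsHorocyclicFrame p u y ∧
      ∀ x : ℝ, T (horocycle p u y x) = horocycle p u y (x + 1) := by
  obtain ⟨y, hyy, hyp, hspan⟩ := exists_neg_sub_one_sq_apply_mem_span hT hp0 hp hTp
  obtain ⟨s, hs⟩ := Submodule.mem_span_singleton.1 hspan
  have htp := herm_sub_one_apply hT hTp y
  set t := (T - 1) y with ht
  have hTy : T y = y + t := by simp [ht]
  have hTt : T t = t + s • p := by simp [hs]
  have hstt : s = herm t t := by
    have hyt := hT y t
    rw [hTy, hTt, herm_add_left, herm_add_right, herm_add_right, herm_smul_right,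
      herm_smul_right, hyp, htp] at hyt
    rw [← star_star s, ← star_herm_self t]
    congr 1
    linear_combination -hyt
  have hyt : 2 * (herm y t).re + (herm t t).re = 0 := by
    have h := congrArg Complex.re (hT y y)
    rw [hTy, herm_add_left, herm_add_right, herm_add_right] at h
    simp only [Complex.add_re] at h
    linarith [re_herm_comm y t]
  set u := t - (herm t t / 2) • p with hu
  have hup : herm u p = 0 := by rw [hu, herm_sub_left, htp, herm_smul_left, hp, mul_zero, sub_zero]
  have huu : herm u u = herm t t := by
    nth_rewrite 2 [hu]
    rw [herm_sub_right, herm_smul_right, hup, hu, herm_sub_left, herm_smul_left,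
      herm_eq_zero_comm.1 htp]
    ring
  refine ⟨u, y, ⟨hp, hup, hyp, ?_, hyy⟩, fun x => ?_⟩
  · rw [hu, herm_sub_right, herm_smul_right, hyp, mul_neg_one, sub_neg_eq_add, star_div₀,
      star_herm_self, star_ofNat, Complex.add_re, Complex.div_ofNat_re]
    linarith
  · rw [horocycle, horocycle, huu, hu]
    simp only [map_add, map_sub, map_smul, hTp, hTy, hTt, hstt]
    push_cast
    module

namespace IsHorocyclicFrame

theorem p_ne_zero (h : IsHorocyclicFrame p u y) : p ≠ 0 := by
  rintro rfl
  simpa [herm] using h.herm_y_p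

theorem herm_horocycle_p (h : IsHorocyclicFrame p u y) (x : ℝ) :
    herm (horocycle p u y x) p = -1 := by
  simp only [horocycle, herm_add_left, herm_smul_left, h.herm_y_p, h.herm_u_p, h.herm_p_p, mul_zero,
    add_zero]

theorem herm_horocycle_horocycle (h : IsHorocyclicFrame p u y) (a b : ℝ) :
    herm (horocycle p u y a) (horocycle p u y b) =
      herm y y - ((a - b : ℝ) : ℂ) ^ 2 / 2 * herm u u - ((a - b : ℝ) : ℂ) * herm y u := by
  have huy : herm u y = -herm y u := by
    rw [← star_herm]
    apply Complex.ext <;> simp [h.re_herm_y_u]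
  have hpy : herm p y = -1 := by rw [← star_herm, h.herm_y_p, star_neg, star_one]
  have hpu := herm_eq_zero_comm.1 h.herm_u_p
  rw [herm_horocycle_right, h.herm_horocycle_p]
  simp only [horocycle, herm_add_left, herm_smul_left, huy, hpy, hpu]
  push_cast
  ring

theorem re_herm_horocycle_self (h : IsHorocyclicFrame p u y) (x : ℝ) :
    (herm (horocycle p u y x) (horocycle p u y x)).re = (herm y y).re := by
  simp [h.herm_horocycle_horocycle]

theorem re_herm_horocycle_self_neg (h : IsHorocyclicFrame p u y) (x : ℝ) :
    (herm (horocycle p u y x) (horocycle p u y x)).re < 0 :=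
  (h.re_herm_horocycle_self x).trans_lt h.re_herm_y_y

theorem norm_herm_horocycle_midpoint (h : IsHorocyclicFrame p u y) (a b : ℝ) :
    ‖herm (horocycle p u y ((a + b) / 2)) (horocycle p u y a)‖ =
      ‖herm (horocycle p u y ((a + b) / 2)) (horocycle p u y b)‖ := by
  rw [← norm_star, star_herm, h.herm_horocycle_horocycle, h.herm_horocycle_horocycle,
    show a - (a + b) / 2 = (a + b) / 2 - b by ring]

variable {z : Vec n}

theorem re_herm_horocycle_neg (h : IsHorocyclicFrame p u y) (hz : (herm z z).re < 0)
    (hzp : herm z p = -1) (x : ℝ) : (herm z (horocycle p u y x)).re < 0 := by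
  have hdiff := re_herm_self_nonneg_of_orthogonal (v := z - horocycle p u y x) h.p_ne_zero
    (by simp [h.herm_p_p]) (by rw [herm_sub_left, hzp, h.herm_horocycle_p, sub_self])
  simp only [herm_sub_left, herm_sub_right, Complex.sub_re] at hdiff
  linarith [re_herm_comm z (horocycle p u y x), h.re_herm_horocycle_self_neg x]

theorem im_herm_ne_zero (h : IsHorocyclicFrame p u y) (hu : u ≠ 0) (huu : (herm u u).re = 0)
    (hzp : herm z p = -1) : (herm z u).im ≠ 0 := by
  obtain ⟨c, rfl⟩ := Submodule.mem_span_singleton.1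
    (mem_span_of_orthogonal h.p_ne_zero (by simp [h.herm_p_p]) h.herm_u_p huu.le)
  have hre : c.re = 0 := by simpa [herm_smul_right, h.herm_y_p] using h.re_herm_y_u
  intro him
  have him' : c.im = 0 := by simpa [herm_smul_right, hzp] using him
  exact hu (by rw [Complex.ext hre him' (w := 0), zero_smul])

theorem strictConvexOn_norm_herm_horocycle_sq (h : IsHorocyclicFrame p u y) (hu : u ≠ 0)
    (hz : (herm z z).re < 0) (hzp : herm z p = -1) :
    StrictConvexOn ℝ Set.univ fun x => ‖herm z (horocycle p u y x)‖ ^ 2 := by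
  have hval (x : ℝ) : herm z (horocycle p u y x) =
      herm z y + x * herm z u - ((x ^ 2 / 2 * (herm u u).re : ℝ) : ℂ) := by
    rw [herm_horocycle_right, hzp, ← ofReal_re_herm_self u]
    push_cast
    rw [Complex.ofReal_re]
    ring
  have hre (x : ℝ) : -(herm z (horocycle p u y x)).re =
      (herm u u).re / 2 * x ^ 2 + -(herm z u).re * x + -(herm z y).re := by
    rw [hval]
    simp only [Complex.sub_re, Complex.add_re, Complex.re_ofReal_mul, Complex.ofReal_re]
    ring
  have him (x : ℝ) : (herm z (horocycle p u y x)).im = (herm z u).im * x + (herm z y).im := by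
    rw [hval]
    simp only [Complex.sub_im, Complex.add_im, Complex.im_ofReal_mul, Complex.ofReal_im]
    ring
  have hsq (x : ℝ) : ‖herm z (horocycle p u y x)‖ ^ 2 =
      (-(herm z (horocycle p u y x)).re) ^ 2 + (herm z (horocycle p u y x)).im ^ 2 := by
    rw [← Complex.normSq_eq_norm_sq, Complex.normSq_apply]
    ring
  have huu : 0 ≤ (herm u u).re :=
    re_herm_self_nonneg_of_orthogonal h.p_ne_zero (by simp [h.herm_p_p]) h.herm_u_p
  simp only [hsq, hre, him]
  refine strictConvexOn_sq_add_sq (fun x => ?_) (by positivity) ?_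
  · rw [← hre]
    exact neg_pos.2 (h.re_herm_horocycle_neg hz hzp x)
  · refine or_iff_not_imp_left.2 fun h0 => h.im_herm_ne_zero hu ?_ hzp
    simpa using h0

theorem strictQuasiconvex_norm_herm_horocycle (h : IsHorocyclicFrame p u y) (hu : u ≠ 0)
    (hz : (herm z z).re < 0) : StrictQuasiconvex fun x => ‖herm z (horocycle p u y x)‖ := by
  have hzp : herm z p ≠ 0 := herm_ne_zero_of_neg_of_nonpos hz h.p_ne_zero (by simp [h.herm_p_p])
  set c : ℂ := -(herm z p)⁻¹ with hc
  have hc0 : 0 < ‖c‖ := norm_pos_iff.2 (neg_ne_zero.2 (inv_ne_zero hzp))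
  have hconv := h.strictConvexOn_norm_herm_horocycle_sq hu (z := c • z)
    (by rw [re_herm_smul_self]; exact mul_neg_of_pos_of_neg (by positivity) hz)
    (by rw [herm_smul_left, hc, neg_mul, inv_mul_cancel₀ hzp])
  refine (strictQuasiconvex_of_strictConvexOn hconv).of_lt_imp_lt fun a b hab => ?_
  rw [sq_lt_sq₀ (norm_nonneg _) (norm_nonneg _)] at hab
  simpa [herm_smul_left, hc0] using hab

end IsHorocyclicFrame

end Horocycle

section Projective

variable {n : ℕ} {v w : Vec n}

theorem norm_dehomog_sq_sub_one_mul (hv : v (Sum.inr ()) ≠ 0) :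
    (‖dehomog v‖ ^ 2 - 1) * ‖v (Sum.inr ())‖ ^ 2 = (herm v v).re := by
  rw [sub_mul, norm_dehomog, if_neg hv, herm_self, Complex.ofReal_re, one_mul]

theorem norm_dehomog_lt_one (hvv : (herm v v).re < 0) : ‖dehomog v‖ < 1 := by
  have hv := last_ne_zero_of_nonpos (ne_zero_of_re_herm_self_neg hvv) hvv.le
  rw [← norm_dehomog_sq_sub_one_mul hv] at hvv
  have hsq := sub_neg.1 (neg_of_mul_neg_left hvv (sq_nonneg _))
  exact (sq_lt_one_iff₀ (norm_nonneg _)).1 hsq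

theorem norm_dehomog_le_one (hv : v ≠ 0) (hvv : (herm v v).re ≤ 0) : ‖dehomog v‖ ≤ 1 := by
  have hlast := last_ne_zero_of_nonpos hv hvv
  rw [← norm_dehomog_sq_sub_one_mul hlast] at hvv
  have hsq := sub_nonpos.1 (nonpos_of_mul_nonpos_left hvv (by positivity))
  exact (sq_le_one_iff₀ (norm_nonneg _)).1 hsq

theorem frac_dehomog (A : U n) (hv : v (Sum.inr ()) ≠ 0) :
    frac A (dehomog v) = dehomog (A.1.val *ᵥ v) := by
  rw [frac, homog_dehomog v hv, Matrix.mulVec_smul, dehomog_smul _ (inv_ne_zero hv)]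

/-- The point of complex hyperbolic space represented by a negative vector. -/
noncomputable def toCH (v : Vec n) (hv : (herm v v).re < 0) : CH n :=
  ⟨dehomog v, mem_ball_zero_iff.2 (norm_dehomog_lt_one hv)⟩

theorem re_herm_homog_neg (z : CH n) : (herm (homog z.1) (homog z.1)).re < 0 := by
  rw [herm_homog_self, Complex.ofReal_re, sub_neg, sq_lt_one_iff₀ (norm_nonneg _)]
  exact mem_ball_zero_iff.1 z.2

theorem toCH_homog (z : CH n) : toCH (homog z.1) (re_herm_homog_neg z) = z :=
  Subtype.ext (dehomog_homog z.1)

theorem re_herm_mulVec_neg (A : U n) (hv : (herm v v).re < 0) :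
    (herm (A.1.val *ᵥ v) (A.1.val *ᵥ v)).re < 0 :=
  (A.2 v v).symm ▸ hv

theorem smul_toCH (A : U n) (hv : (herm v v).re < 0) :
    (A : PU n) • toCH v hv = toCH (A.1.val *ᵥ v) (re_herm_mulVec_neg A hv) :=
  Subtype.ext (frac_dehomog A (last_ne_zero_of_nonpos (ne_zero_of_re_herm_self_neg hv) hv.le))

theorem bdist_toCH (hv : (herm v v).re < 0) (hw : (herm w w).re < 0) :
    bdist (toCH v hv) (toCH w hw) =
      2 * Real.arcosh (‖herm v w‖ / √((herm v v).re * (herm w w).re)) := by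
  have hv0 := last_ne_zero_of_nonpos (ne_zero_of_re_herm_self_neg hv) hv.le
  have hw0 := last_ne_zero_of_nonpos (ne_zero_of_re_herm_self_neg hw) hw.le
  have hc : ‖(v (Sum.inr ()))⁻¹‖ * ‖(w (Sum.inr ()))⁻¹‖ ≠ 0 := by simp [hv0, hw0]
  rw [bdist, toCH, toCH, homog_dehomog v hv0, homog_dehomog w hw0, re_herm_smul_self,
    re_herm_smul_self, herm_smul_left, herm_smul_right, norm_mul, norm_mul, norm_star,
    mul_mul_mul_comm, ← mul_pow, Real.sqrt_mul (by positivity), Real.sqrt_sq (by positivity),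
    ← mul_assoc, mul_div_mul_left _ _ hc]

theorem bdist_toCH_lt_bdist_toCH {z : Vec n} (hz : (herm z z).re < 0) (hv : (herm v v).re < 0)
    (hw : (herm w w).re < 0) (hvw : (herm v v).re = (herm w w).re)
    (hlt : ‖herm z v‖ < ‖herm z w‖) :
    bdist (toCH z hz) (toCH v hv) < bdist (toCH z hz) (toCH w hw) := by
  have hzv : 0 < ‖herm z v‖ := norm_pos_iff.2
    (herm_ne_zero_of_neg_of_nonpos hz (ne_zero_of_re_herm_self_neg hv) hv.le)
  have hsqrt : 0 < √((herm z z).re * (herm w w).re) :=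
    Real.sqrt_pos.2 (mul_pos_of_neg_of_neg hz hw)
  rw [bdist_toCH, bdist_toCH, hvw]
  gcongr
  exact (Real.arcosh_lt_arcosh (by positivity) (div_pos (hzv.trans hlt) hsqrt)).2 (by gcongr)

end Projective

section Parabolic

variable {n : ℕ}

theorem exists_mulVec_homog_eq_smul {A : U n} {q : CHbar n} (h : (A : PU n) • q = q) :
    ∃ l : ℂ, l ≠ 0 ∧ A.1.val *ᵥ homog q.1 = l • homog q.1 := by
  have hlast := last_ne_zero A q
  have hq : dehomog (A.1.val *ᵥ homog q.1) = q.1 := congrArg Subtype.val h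
  refine ⟨_, hlast, ?_⟩
  rw [← (inv_smul_eq_iff₀ hlast), ← homog_dehomog _ hlast, hq]

theorem mem_span_homog_of_eigenvector {A : U n} {q : CHbar n}
    (hq : ∀ q' : CHbar n, (A : PU n) • q' = q' → q' = q) {w : Vec n} {m : ℂ}
    (hww : (herm w w).re ≤ 0) (hm : m ≠ 0) (hAw : A.1.val *ᵥ w = m • w) :
    w ∈ Submodule.span ℂ {homog q.1} := by
  rcases eq_or_ne w 0 with rfl | hw
  · exact zero_mem _
  have hlast := last_ne_zero_of_nonpos hw hww
  have hfix : frac A (dehomog w) = dehomog w := by rw [frac_dehomog A hlast, hAw, dehomog_smul m hm]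
  have hqw : dehomog w = q.1 := congrArg Subtype.val
    (hq ⟨dehomog w, mem_closedBall_zero_iff.2 (norm_dehomog_le_one hw hww)⟩ (Subtype.ext hfix))
  rw [Submodule.mem_span_singleton, ← hqw, homog_dehomog w hlast]
  exact ⟨_, smul_inv_smul₀ hlast w⟩

theorem norm_eigenvalue_eq_one {A : U n} {q : CHbar n}
    (hq : ∀ q' : CHbar n, (A : PU n) • q' = q' → q' = q) {l : ℂ} (hl : l ≠ 0)
    (hAq : A.1.val *ᵥ homog q.1 = l • homog q.1) : ‖l‖ = 1 := by
  have hq0 : homog q.1 ≠ 0 := fun h => one_ne_zero (congrFun h (Sum.inr ()))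
  have hT (v w : Vec n) : herm (A.1.val.mulVecLin v) (A.1.val.mulVecLin w) = herm v w := A.2 v w
  have hTl : Module.End.HasEigenvalue A.1.val.mulVecLin l :=
    Module.End.hasEigenvalue_of_hasEigenvector ⟨Module.End.mem_eigenspace_iff.2 hAq, hq0⟩
  obtain ⟨w, hw⟩ := (hasEigenvalue_inv_star hT hl hTl).exists_hasEigenvector
  have hAw : A.1.val *ᵥ w = (star l)⁻¹ • w := hw.apply_eq_smul
  by_contra hl1
  have hww : herm w w = 0 :=
    herm_self_eq_zero_of_norm_ne_one hT (m := (star l)⁻¹) (by simpa using hl1) hAw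
  obtain ⟨c, rfl⟩ := Submodule.mem_span_singleton.1 (mem_span_homog_of_eigenvector hq
    (by simp [hww]) (inv_ne_zero (star_ne_zero.2 hl)) hAw)
  have heq : l = (star l)⁻¹ := by
    rw [Matrix.mulVec_smul, hAq, smul_comm] at hAw
    exact smul_left_injective ℂ hw.2 hAw
  have hnorm := congrArg norm heq
  rw [norm_inv, norm_star, ← mul_eq_one_iff_eq_inv₀ (norm_ne_zero_iff.2 hl), ← sq] at hnorm
  exact hl1 ((pow_eq_one_iff_of_nonneg (norm_nonneg l) two_ne_zero).1 hnorm)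

theorem exists_mk_eq_and_mulVec_eq_self {A : U n} {v : Vec n} {l : ℂ} (hl : ‖l‖ = 1)
    (hAv : A.1.val *ᵥ v = l • v) : ∃ B : U n, (B : PU n) = A ∧ B.1.val *ᵥ v = v := by
  have hl0 : l ≠ 0 := by rintro rfl; simp at hl
  let c : GL (Fin n ⊕ Unit) ℂ :=
    Matrix.GeneralLinearGroup.scalar _ (Units.mk0 l⁻¹ (inv_ne_zero hl0))
  have hc (v : Vec n) : c.val *ᵥ v = l⁻¹ • v := by
    funext j
    simp [c, Matrix.mulVec_diagonal]
  let C : U n := ⟨c, fun v w => by simp [hc, herm_smul_smul_self, hl]⟩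
  have hC : (C : PU n) = 1 := (QuotientGroup.eq_one_iff C).2 ⟨_, rfl⟩
  refine ⟨C * A, by rw [QuotientGroup.mk_mul, hC, one_mul], ?_⟩
  change (c.val * A.1.val) *ᵥ v = v
  rw [← Matrix.mulVec_mulVec, hAv, hc, inv_smul_smul₀ hl0]

theorem IsParabolic.exists_isHorocyclicFrame {g : PU n} (hg : IsParabolic g) :
    ∃ (A : U n) (p u y : Vec n), (A : PU n) = g ∧ IsHorocyclicFrame p u y ∧ u ≠ 0 ∧
      ∀ x : ℝ, A.1.val *ᵥ horocycle p u y x = horocycle p u y (x + 1) := by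
  obtain ⟨q, hq1, hq⟩ := hg
  obtain ⟨A, rfl, hAq⟩ : ∃ A : U n, (A : PU n) = g ∧ A.1.val *ᵥ homog q.1 = homog q.1 := by
    obtain ⟨B, rfl⟩ := QuotientGroup.mk_surjective g
    obtain ⟨l, hl, hBq⟩ := exists_mulVec_homog_eq_smul ((hq q).2 rfl)
    exact exists_mk_eq_and_mulVec_eq_self (norm_eigenvalue_eq_one (fun q' => (hq q').1) hl hBq) hBq
  have hp0 : homog q.1 ≠ 0 := fun h => one_ne_zero (congrFun h (Sum.inr ()))
  have hp : herm (homog q.1) (homog q.1) = 0 := by simp [herm_homog_self, hq1]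
  obtain ⟨u, y, hframe, hcurve⟩ :=
    exists_isHorocyclicFrame_of_apply_eq_self (T := Matrix.mulVecLin A.1.val) A.2 hp0 hp hAq
  refine ⟨A, homog q.1, u, y, rfl, hframe, ?_, hcurve⟩
  rintro rfl
  have hAy : A.1.val *ᵥ y = (1 : ℂ) • y := by simpa [horocycle, herm_zero_left] using hcurve 0
  obtain ⟨c, hc⟩ := Submodule.mem_span_singleton.1 (mem_span_homog_of_eigenvector
    (fun q' => (hq q').1) hframe.re_herm_y_y.le one_ne_zero hAy)
  simpa [← hc, herm_smul_left, hp] using hframe.herm_y_p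

theorem zpow_mulVec_apply {A : U n} {γ : ℝ → Vec n} (hA : ∀ x, A.1.val *ᵥ γ x = γ (x + 1))
    (k : ℤ) (x : ℝ) : (A ^ k).1.val *ᵥ γ x = γ (x + k) := by
  have hmul (B C : U n) (v : Vec n) : (B * C).1.val *ᵥ v = B.1.val *ᵥ (C.1.val *ᵥ v) :=
    (Matrix.mulVec_mulVec v B.1.val C.1.val).symm
  have hinv (x : ℝ) : (A⁻¹).1.val *ᵥ γ x = γ (x - 1) := by
    rw [← sub_add_cancel x 1, ← hA, ← hmul, inv_mul_cancel]
    simp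
  induction k generalizing x with
  | zero => simp
  | succ i ih =>
    rw [zpow_add_one, hmul, hA, ih]
    congr 1; push_cast; ring
  | pred i ih =>
    rw [zpow_sub_one, hmul, hinv, ih]
    congr 1; push_cast; ring

theorem IsParabolic.exists_strictQuasiconvex_orbit {g : PU n} (hg : IsParabolic g) :
    ∃ y : CH n, (∀ z, StrictQuasiconvex fun k : ℤ => bdist z (g ^ k • y)) ∧
      ∀ k : ℤ, (bisector y (g ^ k • y)).Nonempty := by
  obtain ⟨A, p, u, y, rfl, hframe, hu, hA⟩ := hg.exists_isHorocyclicFrame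
  set γ := horocycle p u y
  have hneg := hframe.re_herm_horocycle_self_neg
  have hnorm := hframe.re_herm_horocycle_self
  have horbit (k : ℤ) : (A : PU n) ^ k • toCH (γ 0) (hneg 0) = toCH (γ k) (hneg k) := by
    rw [← QuotientGroup.mk_zpow, smul_toCH]
    simp only [zpow_mulVec_apply hA, zero_add]
  refine ⟨toCH (γ 0) (hneg 0), fun z => ?_, fun k => ⟨toCH (γ ((0 + k) / 2)) (hneg _), ?_⟩⟩
  · have hquasi := (hframe.strictQuasiconvex_norm_herm_horocycle hu
      (re_herm_homog_neg z)).comp_strictMono (Int.cast_strictMono (R := ℝ))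
    refine hquasi.of_lt_imp_lt fun j k hjk => ?_
    rw [horbit, horbit, ← toCH_homog z]
    exact bdist_toCH_lt_bdist_toCH _ _ _ ((hnorm j).trans (hnorm k).symm) hjk
  · change bdist _ _ = bdist _ _
    rw [horbit, bdist_toCH, bdist_toCH, hnorm 0, hnorm k,
      hframe.norm_herm_horocycle_midpoint]

end Parabolic

section Sides

variable {n : ℕ} {g : PU n} {y z : CH n}

theorem lt_bdist_zpow_smul (hz : StrictQuasiconvex fun k : ℤ => bdist z (g ^ k • y))
    (h₁ : bdist z y ≤ bdist z (g • y)) (h₂ : bdist z y ≤ bdist z (g⁻¹ • y)) {k : ℤ} (hk0 : k ≠ 0)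
    (hk1 : k ≠ 1) (hk2 : k ≠ -1) : bdist z y < bdist z (g ^ k • y) := by
  rcases hk0.lt_or_gt with hk | hk
  · exact h₂.trans_lt (by
      simpa using hz.lt_left (show k < -1 by lia) (show (-1 : ℤ) < 0 by lia) (by simpa using h₂))
  · exact h₁.trans_lt (by
      simpa using hz.lt_right zero_lt_one (show 1 < k by lia) (by simpa using h₁))

theorem mem_dirichlet_zpowers_iff (hz : StrictQuasiconvex fun k : ℤ => bdist z (g ^ k • y)) :
    z ∈ dirichlet (Subgroup.zpowers g) y ↔
      bdist z y ≤ bdist z (g • y) ∧ bdist z y ≤ bdist z (g⁻¹ • y) := by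
  refine ⟨fun h => ⟨h g (Subgroup.mem_zpowers g), h g⁻¹ (inv_mem (Subgroup.mem_zpowers g))⟩, ?_⟩
  rintro ⟨h₁, h₂⟩ _ ⟨k, rfl⟩
  rcases eq_or_ne k 0 with rfl | hk0
  · simp
  rcases eq_or_ne k 1 with rfl | hk1
  · simpa using h₁
  rcases eq_or_ne k (-1) with rfl | hk2
  · simpa using h₂
  exact (lt_bdist_zpow_smul hz h₁ h₂ hk0 hk1 hk2).le

theorem bdist_lt_bdist_inv_smul (hz : StrictQuasiconvex fun k : ℤ => bdist z (g ^ k • y))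
    (h : z ∈ bisector y (g • y)) : bdist z y < bdist z (g⁻¹ • y) := by
  simpa using hz.lt_left neg_one_lt_zero zero_lt_one (by simpa using (Eq.ge h))

theorem bdist_lt_bdist_smul (hz : StrictQuasiconvex fun k : ℤ => bdist z (g ^ k • y))
    (h : z ∈ bisector y (g⁻¹ • y)) : bdist z y < bdist z (g • y) := by
  simpa using hz.lt_right neg_one_lt_zero zero_lt_one (by simpa using (Eq.ge h))

theorem isSide_bisector {G : Subgroup (PU n)} {h : PU n} (hG : h ∈ G) (hy : h • y ≠ y)
    (hne : (bisector y (h • y)).Nonempty) (hsub : bisector y (h • y) ⊆ dirichlet G y) :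
    IsSide G y (bisector y (h • y)) :=
  ⟨h, hG, hy, (Set.inter_eq_right.2 hsub).symm, Set.univ, isOpen_univ, by simpa using hne, by simp⟩

theorem setOf_isSide_zpowers (hquasi : ∀ z, StrictQuasiconvex fun k : ℤ => bdist z (g ^ k • y))
    (hne₁ : (bisector y (g • y)).Nonempty) (hne₂ : (bisector y (g⁻¹ • y)).Nonempty) :
    {S | IsSide (Subgroup.zpowers g) y S} = {bisector y (g • y), bisector y (g⁻¹ • y)} := by
  have hgy : g • y ≠ y := fun h => (bdist_lt_bdist_inv_smul (hquasi y)
    (show bdist y y = bdist y (g • y) by rw [h])).ne (by rw [inv_smul_eq_iff.2 h.symm])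
  have hsub₁ : bisector y (g • y) ⊆ dirichlet (Subgroup.zpowers g) y := fun z hz =>
    (mem_dirichlet_zpowers_iff (hquasi z)).2 ⟨Eq.le hz, (bdist_lt_bdist_inv_smul (hquasi z) hz).le⟩
  have hsub₂ : bisector y (g⁻¹ • y) ⊆ dirichlet (Subgroup.zpowers g) y := fun z hz =>
    (mem_dirichlet_zpowers_iff (hquasi z)).2 ⟨(bdist_lt_bdist_smul (hquasi z) hz).le, Eq.le hz⟩
  ext S
  constructor
  · rintro ⟨_, ⟨k, rfl⟩, hky, rfl, V, -, ⟨z, hzV⟩, hV⟩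
    beta_reduce at hky hzV hV ⊢
    have hk0 : k ≠ 0 := by rintro rfl; simp at hky
    rcases eq_or_ne k 1 with rfl | hk1
    · left
      rw [zpow_one, Set.inter_eq_right.2 hsub₁]
    rcases eq_or_ne k (-1) with rfl | hk2
    · right
      rw [zpow_neg_one, Set.inter_eq_right.2 hsub₂, Set.mem_singleton_iff]
    obtain ⟨h₁, h₂⟩ := (mem_dirichlet_zpowers_iff (hquasi z)).1 (hV hzV).1
    exact absurd hzV.2 (lt_bdist_zpow_smul (hquasi z) h₁ h₂ hk0 hk1 hk2).ne
  · rintro (rfl | rfl)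
    · exact isSide_bisector (Subgroup.mem_zpowers g) hgy hne₁ hsub₁
    · exact isSide_bisector (inv_mem (Subgroup.mem_zpowers g))
        (fun h => hgy (inv_smul_eq_iff.1 h).symm) hne₂ hsub₂

theorem bisector_smul_ne_bisector_inv_smul
    (hquasi : ∀ z, StrictQuasiconvex fun k : ℤ => bdist z (g ^ k • y))
    (hne : (bisector y (g • y)).Nonempty) : bisector y (g • y) ≠ bisector y (g⁻¹ • y) := by
  obtain ⟨z, hz⟩ := hne
  exact fun h => (bdist_lt_bdist_inv_smul (hquasi z) hz).ne
    (show z ∈ bisector y (g⁻¹ • y) from h ▸ hz)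

end Sides

end ComplexHyperbolic

theorem theorem3p1 (n : ℕ) (G : Subgroup (ComplexHyperbolic.PU n)) (hG : DiscreteTopology G)
    (hgen : ∃ g : ComplexHyperbolic.PU n,
      ComplexHyperbolic.IsParabolic g ∧ G = Subgroup.zpowers g) :
    ∃ y₀ : ComplexHyperbolic.CH n,
      {S : Set (ComplexHyperbolic.CH n) | ComplexHyperbolic.IsSide G y₀ S}.ncard = 2 := by
  obtain ⟨g, hg, rfl⟩ := hgen
  obtain ⟨y, hquasi, hbisector⟩ := hg.exists_strictQuasiconvex_orbit
  have hne₁ : (ComplexHyperbolic.bisector y (g • y)).Nonempty := by simpa using hbisector 1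
  have hne₂ : (ComplexHyperbolic.bisector y (g⁻¹ • y)).Nonempty := by simpa using hbisector (-1)
  refine ⟨y, ?_⟩
  rw [ComplexHyperbolic.setOf_isSide_zpowers hquasi hne₁ hne₂,
    Set.ncard_pair (ComplexHyperbolic.bisector_smul_ne_bisector_inv_smul hquasi hne₁)]
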